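/- Let $A$ be an infinite abelian group, written multiplicatively. A restricted $2$-subgroup of $A$ is a subgroup $E_2\le A$ all of whose non-identity elements are involutions that are not squares in $A$, and which is maximal (with respect to inclusion) among the subgroups with this property; every abelian group has one, and if the set consisting of the identity and all involutions of $A$ that are not squares is a subgroup, then this set is the unique restricted $2$-subgroup. A strong complete mapping of $A$ is a bijection $\theta\colon A\to A$ such that both $g\mapsto g^{-1}\theta(g)$ and $g\mapsto g\,\theta(g)$ are bijections of $A$. Theorem. Let $A$ be an infinite abelian group and let $E_2$ be a restricted $2$-subgroup of $A$. Then $A$ has a strong complete mapping, except possibly when $A/E_2$ is finite and has a nontrivial cyclic Sylow $3$-subgroup. -/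

import Mathlib

/-- `θ` is an orthomorphism of `G`: both `θ` and `g ↦ g⁻¹ θ(g)` are bijections of `G`. -/
def IsOrthomorphism {G : Type*} [Group G] (θ : G → G) : Prop :=
  Function.Bijective θ ∧ Function.Bijective (fun g => g⁻¹ * θ g)

/-- `θ` is a complete mapping of `G`: both `θ` and `g ↦ g θ(g)` are bijections of `G`. -/
def IsCompleteMapping {G : Type*} [Group G] (θ : G → G) : Prop :=
  Function.Bijective θ ∧ Function.Bijective (fun g => g * θ g)

/-- A strong complete mapping is both an orthomorphism and a complete mapping. -/
def IsStrongCompleteMapping {G : Type*} [Group G] (θ : G → G) : Prop :=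
  IsOrthomorphism θ ∧ IsCompleteMapping θ

/-- The identity together with the involutions that are not squares. This set need not be closed
under multiplication (in `ℤ/4 × ℤ/2` it is not). -/
def restrictedTwoSet (A : Type*) [CommGroup A] : Set A :=
  {x | x = 1 ∨ (orderOf x = 2 ∧ ¬ IsSquare x)}

/-- `E` is a restricted `2`-subgroup of the abelian group `A`: a subgroup consisting of the
identity and involutions that are not squares in `A`, and maximal among such subgroups. -/
def IsRestrictedTwoSubgroup {A : Type*} [CommGroup A] (E : Subgroup A) : Prop :=
  Maximal (fun H : Subgroup A => (H : Set A) ⊆ restrictedTwoSet A) E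

/-- Every abelian group has a restricted `2`-subgroup. -/
theorem exists_isRestrictedTwoSubgroup (A : Type*) [CommGroup A] :
    ∃ E : Subgroup A, IsRestrictedTwoSubgroup E := by
  refine zorn_le₀ {H : Subgroup A | (H : Set A) ⊆ restrictedTwoSet A} ?_
  intro c hc hchain
  rcases c.eq_empty_or_nonempty with rfl | hne
  · refine ⟨⊥, ?_, by simp⟩
    intro x hx
    exact Or.inl (by simpa using hx)
  · refine ⟨sSup c, ?_, fun z hz => le_sSup hz⟩
    intro x hx
    obtain ⟨H, hH, hxH⟩ := (Subgroup.mem_sSup_of_directedOn hne hchain.directedOn).1 hx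
    exact hc hH hxH

/-- If the identity together with the involutions that are not squares is a subgroup, then this is
the only restricted `2`-subgroup. -/
theorem isRestrictedTwoSubgroup_iff_of_coe_eq {A : Type*} [CommGroup A] {E₂ : Subgroup A}
    (h : (E₂ : Set A) = restrictedTwoSet A) (E : Subgroup A) :
    IsRestrictedTwoSubgroup E ↔ E = E₂ := by
  constructor
  · intro hE
    have hle : E ≤ E₂ := by
      intro x hx
      have hx' : x ∈ (E₂ : Set A) := h ▸ hE.prop hx
      exact hx'
    exact le_antisymm hle (hE.le_of_ge h.le hle)
  · rintro rfl
    refine ⟨h.le, ?_⟩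
    intro H hH _ x hx
    have hx' : x ∈ (E : Set A) := h ▸ hH hx
    exact hx'

/-! Written additively, a strong complete mapping is a set of pairs (g, h) on which the first
coordinate, the second coordinate, h + g and h - g each take every value exactly once. It is built
by transfinite recursion (`exists_forall_done_of_extension`), with fewer than |G| pairs at each
stage. The obstacle is that h + g and h - g differ by 2g. If |2G| = |G|, there is room to add pairs
one by one. If |2G| < |G|, a coset of 2G offers too little room, so `exists_block` fills all its
sums and differences at once by the pairs (g + e_x, h + x - e_x), x in 2G, with 2e_x = 0. Enough
such e_x exist because |G| = |2G| |G[2]| forces G[2] to meet |G| cosets of 2G. -/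

open Cardinal Set

universe u

/-! ### Transfinite recursion and avoidance -/

/-- A finitary property of sets that can be enlarged at small cost to perform any given task holds
for a set performing all tasks: the transfinite form of a back-and-forth construction. -/
theorem exists_forall_done_of_extension {X T : Type u} [Infinite T] (Good : Set X → Prop)
    (Done : T → Set X → Prop) (μ : Cardinal.{u}) (hμ : μ < #T)
    (done_mono : ∀ t S S', S ⊆ S' → Done t S → Done t S')
    (good_sUnion : ∀ c : Set (Set X), IsChain (· ⊆ ·) c → (∀ S ∈ c, Good S) → Good (⋃₀ c))
    (step : ∀ S t, Good S → #S < #T → ∃ D : Set X, #D ≤ μ ∧ Good (S ∪ D) ∧ Done t (S ∪ D)) :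
    ∃ S, Good S ∧ ∀ t, Done t S := by
  classical
  choose! ext ext_card ext_good ext_done using step
  -- Indexing by the initial ordinal of `#T` makes every proper initial segment smaller than `#T`.
  let ι := (#T).ord.ToType
  obtain ⟨τ⟩ : Nonempty (ι ≃ T) := Cardinal.eq.1 (by simp [ι])
  let F : ι → Set X := (wellFounded_lt (α := ι)).fix
    fun i F => ext (⋃ j : Iio i, F j.1 j.2) (τ i)
  have hF : ∀ i, F i = ext (⋃ j : Iio i, F j.1) (τ i) := fun i => WellFounded.fix_eq _ _ _
  let U : ι → Set X := fun i => ⋃ j : Iio i, F j.1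
  let V : ι → Set X := fun i => U i ∪ F i
  have F_sub : ∀ {i j}, j < i → F j ⊆ U i := fun {i j} h =>
    subset_iUnion (fun j : Iio i => F j.1) ⟨j, h⟩
  have hV : Monotone V := by
    intro i j hij
    rcases hij.eq_or_lt with rfl | hij
    · exact le_rfl
    · refine union_subset (iUnion_subset fun k => ?_) ?_
      · exact (F_sub (lt_trans k.2 hij)).trans subset_union_left
      · exact (F_sub hij).trans subset_union_left
  have chain : ∀ s : Set ι, IsChain (· ⊆ ·) (V '' s) := by
    rintro s _ ⟨i, -, rfl⟩ _ ⟨j, -, rfl⟩ -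
    exact (le_total i j).imp (fun h => hV h) (fun h => hV h)
  have U_eq : ∀ i, U i = ⋃₀ (V '' Iio i) := by
    intro i
    refine Subset.antisymm (iUnion_subset fun j => ?_) (sUnion_subset ?_)
    · exact subset_union_right.trans (subset_sUnion_of_mem (mem_image_of_mem V j.2))
    · rintro _ ⟨j, hj, rfl⟩
      exact union_subset (iUnion_subset fun k => F_sub (lt_trans k.2 hj)) (F_sub hj)
  have U_card : ∀ i, (∀ j < i, #(F j) ≤ μ) → #(U i) < #T := by
    intro i hi
    refine (mk_iUnion_le _).trans_lt (mul_lt_of_lt (aleph0_le_mk T) ?_ ?_)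
    · exact (mk_Iio_lt i (by simp [ι])).trans_eq (by simp [ι])
    · exact (ciSup_le' fun j : Iio i => hi j.1 j.2).trans_lt hμ
  -- `ext` is meaningful only on good small sets, so this induction validates each stage of the
  -- recursion.
  have key : ∀ i, Good (U i) ∧ #(U i) < #T := by
    intro i
    induction i using WellFoundedLT.induction with
    | ind i ih =>
      refine ⟨?_, U_card i fun j hj => ?_⟩
      · rw [U_eq]
        refine good_sUnion _ (chain _) ?_
        rintro _ ⟨j, hj, rfl⟩
        simp only [V, hF j]
        exact ext_good _ _ (ih j hj).1 (ih j hj).2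
      · rw [hF j]
        exact ext_card _ _ (ih j hj).1 (ih j hj).2
  refine ⟨⋃₀ (V '' univ), good_sUnion _ (chain _) ?_, fun t => ?_⟩
  · rintro _ ⟨j, -, rfl⟩
    simp only [V, hF j]
    exact ext_good _ _ (key j).1 (key j).2
  · refine done_mono t (V (τ.symm t)) _
      (subset_sUnion_of_mem (mem_image_of_mem V (mem_univ _))) ?_
    have := ext_done _ (τ (τ.symm t)) (key (τ.symm t)).1 (key (τ.symm t)).2
    simp only [V, hF (τ.symm t)]
    rwa [τ.apply_symm_apply] at this ⊢

/-- Fewer than `#W` values of each of three injections can be avoided simultaneously. -/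
theorem exists_notMem_of_injective {W Y : Type u} [Infinite W] {f₁ f₂ f₃ : W → Y}
    (h₁ : f₁.Injective) (h₂ : f₂.Injective) (h₃ : f₃.Injective) {Z₁ Z₂ Z₃ : Set Y}
    (c₁ : #Z₁ < #W) (c₂ : #Z₂ < #W) (c₃ : #Z₃ < #W) :
    ∃ w, f₁ w ∉ Z₁ ∧ f₂ w ∉ Z₂ ∧ f₃ w ∉ Z₃ := by
  by_contra! h
  have hcover : (univ : Set W) ⊆ (f₁ ⁻¹' Z₁ ∪ f₂ ⁻¹' Z₂) ∪ f₃ ⁻¹' Z₃ := by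
    intro w _
    by_cases h1 : f₁ w ∈ Z₁
    · exact Or.inl (Or.inl h1)
    by_cases h2 : f₂ w ∈ Z₂
    · exact Or.inl (Or.inr h2)
    exact Or.inr (h w h1 h2)
  have hW := aleph0_le_mk W
  have hlt : #((f₁ ⁻¹' Z₁ ∪ f₂ ⁻¹' Z₂) ∪ f₃ ⁻¹' Z₃ : Set W) < #W :=
    (mk_union_le _ _).trans_lt <| add_lt_of_lt hW
      ((mk_union_le _ _).trans_lt <| add_lt_of_lt hW
        ((mk_preimage_of_injective _ _ h₁).trans_lt c₁)
        ((mk_preimage_of_injective _ _ h₂).trans_lt c₂))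
      ((mk_preimage_of_injective _ _ h₃).trans_lt c₃)
  exact absurd ((mk_univ (α := W)).symm.trans_le (mk_le_mk_of_subset hcover)) hlt.not_ge

theorem InjOn.union_of_notMem_image {X Y : Type*} {f : X → Y} {S D : Set X} (hS : InjOn f S)
    (hD : InjOn f D) (h : ∀ p ∈ D, f p ∉ f '' S) : InjOn f (S ∪ D) := by
  rintro p (hp | hp) q (hq | hq) e
  · exact hS hp hq e
  · exact absurd ⟨p, hp, e⟩ (h q hq)
  · exact absurd ⟨q, hq, e.symm⟩ (h p hp)
  · exact hD hp hq e

theorem IsChain.injOn_sUnion {X Y : Type*} {f : X → Y} {c : Set (Set X)}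
    (hc : IsChain (· ⊆ ·) c) (h : ∀ S ∈ c, InjOn f S) : InjOn f (⋃₀ c) := by
  rintro p ⟨S, hS, hp⟩ q ⟨S', hS', hq⟩ e
  rcases hc.total hS hS' with hle | hle
  · exact h S' hS' (hle hp) hq e
  · exact h S hS hp (hle hq) e

section Additive

variable {G : Type u} [AddCommGroup G]

/-! ### Partial strong complete mappings -/

/-- The graph of a partial strong complete mapping. -/
structure IsPartialSCM (S : Set (G × G)) : Prop where
  fst : InjOn Prod.fst S
  snd : InjOn Prod.snd S
  sum : InjOn (fun p : G × G => p.1 + p.2) S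
  diff : InjOn (fun p : G × G => -p.1 + p.2) S

theorem IsPartialSCM.sUnion {c : Set (Set (G × G))} (hc : IsChain (· ⊆ ·) c)
    (h : ∀ S ∈ c, IsPartialSCM S) : IsPartialSCM (⋃₀ c) :=
  ⟨hc.injOn_sUnion fun S hS => (h S hS).fst, hc.injOn_sUnion fun S hS => (h S hS).snd,
    hc.injOn_sUnion fun S hS => (h S hS).sum, hc.injOn_sUnion fun S hS => (h S hS).diff⟩

theorem IsPartialSCM.union {S D : Set (G × G)} (hS : IsPartialSCM S) (hD : IsPartialSCM D)
    (h₁ : ∀ p ∈ D, p.1 ∉ Prod.fst '' S) (h₂ : ∀ p ∈ D, p.2 ∉ Prod.snd '' S)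
    (h₃ : ∀ p ∈ D, p.1 + p.2 ∉ (fun p : G × G => p.1 + p.2) '' S)
    (h₄ : ∀ p ∈ D, -p.1 + p.2 ∉ (fun p : G × G => -p.1 + p.2) '' S) : IsPartialSCM (S ∪ D) :=
  ⟨InjOn.union_of_notMem_image hS.fst hD.fst h₁, InjOn.union_of_notMem_image hS.snd hD.snd h₂,
    InjOn.union_of_notMem_image hS.sum hD.sum h₃, InjOn.union_of_notMem_image hS.diff hD.diff h₄⟩

theorem IsPartialSCM.singleton (p : G × G) : IsPartialSCM {p} :=
  ⟨injOn_singleton _ _, injOn_singleton _ _, injOn_singleton _ _, injOn_singleton _ _⟩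

theorem IsPartialSCM.exists_map {S : Set (G × G)} (hS : IsPartialSCM S)
    (h₁ : ∀ g, g ∈ Prod.fst '' S) (h₂ : ∀ g, g ∈ Prod.snd '' S)
    (h₃ : ∀ g, g ∈ (fun p : G × G => p.1 + p.2) '' S)
    (h₄ : ∀ g, g ∈ (fun p : G × G => -p.1 + p.2) '' S) :
    ∃ θ : G → G, θ.Bijective ∧ (fun g => -g + θ g).Bijective ∧ (fun g => g + θ g).Bijective := by
  have hex : ∀ g, ∃ h, (g, h) ∈ S := by
    intro g
    obtain ⟨⟨a, b⟩, hp, rfl⟩ := h₁ g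
    exact ⟨b, hp⟩
  choose θ hθ using hex
  have huniq : ∀ p ∈ S, p.2 = θ p.1 := fun p hp =>
    congrArg Prod.snd (hS.fst hp (hθ p.1) rfl)
  have bij : ∀ f : G × G → G, InjOn f S → (∀ g, g ∈ f '' S) →
      (fun g => f (g, θ g)).Bijective := by
    intro f hf hs
    refine ⟨fun a b e => congrArg Prod.fst (hf (hθ a) (hθ b) e), fun g => ?_⟩
    obtain ⟨⟨a, b⟩, hp, rfl⟩ := hs g
    exact ⟨a, by rw [show b = θ a from huniq _ hp]⟩
  exact ⟨θ, bij _ hS.snd h₂, bij _ hS.diff h₄, bij _ hS.sum h₃⟩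

/-! ### Groups with as many doubles as elements -/

/-- Doubling. -/
abbrev dbl (G : Type u) [AddCommGroup G] : G →+ G := nsmulAddMonoidHom 2

theorem dbl_apply (g : G) : dbl G g = g + g := by simp [two_nsmul]

theorem AddMonoidHom.mk_eq_range_mul_ker {H : Type u} [AddCommGroup H] (f : G →+ H) :
    #G = #f.range * #f.ker := by
  rw [mk_congr (AddSubgroup.addGroupEquivQuotientProdAddSubgroup (s := f.ker)), mk_prod,
    mk_congr (QuotientAddGroup.quotientKerEquivRange f).toEquiv]
  simp

/-- Each task fixes one of the four values of a new pair and leaves |G| choices for which the other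
three are injective functions of the choice, so fewer than |G| used values can be avoided. -/
theorem exists_scm_of_mk_range_dbl_eq [Infinite G] (hr : #(dbl G).range = #G) :
    ∃ θ : G → G, θ.Bijective ∧ (fun g => -g + θ g).Bijective ∧ (fun g => g + θ g).Bijective := by
  let f : Fin 4 → G × G → G := ![Prod.fst, Prod.snd, fun p => p.1 + p.2, fun p => -p.1 + p.2]
  have hT : #(Fin 4 × G) = #G := by
    rw [mk_prod]
    simpa using mul_eq_right (aleph0_le_mk G)
      ((natCast_lt_aleph0 (n := 4)).le.trans (aleph0_le_mk G)) (by simp)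
  have hinf : Infinite (dbl G).range := by
    rw [infinite_iff, hr]; exact aleph0_le_mk G
  choose sec hsec using fun w : (dbl G).range => w.2
  have sec_inj : sec.Injective := fun a b e => Subtype.ext (by rw [← hsec a, ← hsec b, e])
  have sec_two : ∀ w, sec w + sec w = w := fun w => by rw [← dbl_apply, hsec]
  refine (exists_forall_done_of_extension (T := Fin 4 × G)
    (IsPartialSCM (G := G)) (fun t S => t.2 ∈ f t.1 '' S) 1
    (by rw [hT]; exact one_lt_aleph0.trans_le (aleph0_le_mk G))
    (fun t S S' h => fun ht => image_mono h ht) (fun c => IsPartialSCM.sUnion) ?_).elim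
    fun S ⟨hS, hd⟩ => hS.exists_map (fun g => hd (0, g)) (fun g => hd (1, g)) (fun g => hd (2, g))
      (fun g => hd (3, g))
  rintro S ⟨i, y⟩ hS hlt
  rw [hT] at hlt
  have im : ∀ k : G × G → G, #(k '' S) < #G := fun k => mk_image_le.trans_lt hlt
  by_cases hy : y ∈ f i '' S
  · exact ⟨∅, by simp, by simpa using hS, by simpa using hy⟩
  suffices ∃ p : G × G, f i p = y ∧ p.1 ∉ Prod.fst '' S ∧ p.2 ∉ Prod.snd '' S ∧
      p.1 + p.2 ∉ (fun p : G × G => p.1 + p.2) '' S ∧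
      -p.1 + p.2 ∉ (fun p : G × G => -p.1 + p.2) '' S by
    obtain ⟨p, hp, h₁, h₂, h₃, h₄⟩ := this
    refine ⟨{p}, by simp, hS.union (.singleton p) ?_ ?_ ?_ ?_, p, Or.inr rfl, hp⟩ <;>
    · rintro _ rfl
      assumption
  fin_cases i
  · obtain ⟨h, h₂, h₃, h₄⟩ := exists_notMem_of_injective (f₁ := fun h : G => h)
      (f₂ := fun h => y + h) (f₃ := fun h => -y + h) (fun _ _ => id) (add_right_injective _)
      (add_right_injective _) (im Prod.snd) (im fun p => p.1 + p.2) (im fun p => -p.1 + p.2)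
    exact ⟨(y, h), rfl, hy, h₂, h₃, h₄⟩
  · obtain ⟨g, h₁, h₃, h₄⟩ := exists_notMem_of_injective (f₁ := fun g : G => g)
      (f₂ := fun g => g + y) (f₃ := fun g => -g + y) (fun _ _ => id) (add_left_injective _)
      ((add_left_injective _).comp neg_injective)
      (im Prod.fst) (im fun p => p.1 + p.2) (im fun p => -p.1 + p.2)
    exact ⟨(g, y), rfl, h₁, hy, h₃, h₄⟩
  -- With sum y the pair is (g, y - g) and its difference is y - 2g; taking g to be the chosen half
  -- of w makes this y - w, injective in w.
  · obtain ⟨w, h₁, h₂, h₄⟩ := exists_notMem_of_injective (f₁ := sec)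
      (f₂ := fun w => -sec w + y) (f₃ := fun w => -(w : G) + y) sec_inj
      ((add_left_injective _).comp (neg_injective.comp sec_inj))
      ((add_left_injective _).comp (neg_injective.comp Subtype.val_injective))
      ((im Prod.fst).trans_eq hr.symm) ((im Prod.snd).trans_eq hr.symm)
      ((im fun p => -p.1 + p.2).trans_eq hr.symm)
    refine ⟨(sec w, -sec w + y), by simp [f], h₁, h₂, by rw [add_neg_cancel_left]; exact hy, ?_⟩
    rwa [show -sec w + (-sec w + y) = -(w : G) + y by rw [← sec_two]; abel]
  · obtain ⟨w, h₁, h₂, h₃⟩ := exists_notMem_of_injective (f₁ := sec)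
      (f₂ := fun w => sec w + y) (f₃ := fun w => (w : G) + y) sec_inj
      ((add_left_injective _).comp sec_inj)
      ((add_left_injective _).comp Subtype.val_injective)
      ((im Prod.fst).trans_eq hr.symm) ((im Prod.snd).trans_eq hr.symm)
      ((im fun p => p.1 + p.2).trans_eq hr.symm)
    refine ⟨(sec w, sec w + y), by simp [f], h₁, h₂, ?_, by rw [neg_add_cancel_left]; exact hy⟩
    rwa [show sec w + (sec w + y) = (w : G) + y by rw [← sec_two]; abel]

/-! ### Groups with few doubles -/

/-- A set of pairs whose sums and differences fill the same cosets of the subgroup of doubles. -/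
structure IsSaturated (S : Set (G × G)) : Prop where
  sum : ∀ p ∈ S, ∀ y, p.1 + p.2 - y ∈ (dbl G).range → ∃ q ∈ S, q.1 + q.2 = y
  diff : ∀ p ∈ S, ∀ y, p.1 + p.2 - y ∈ (dbl G).range → ∃ q ∈ S, -q.1 + q.2 = y

theorem IsSaturated.sUnion {c : Set (Set (G × G))} (h : ∀ S ∈ c, IsSaturated S) :
    IsSaturated (⋃₀ c) := by
  constructor
  · rintro p ⟨S, hS, hp⟩ y hy
    obtain ⟨q, hq, e⟩ := (h S hS).sum p hp y hy
    exact ⟨q, ⟨S, hS, hq⟩, e⟩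
  · rintro p ⟨S, hS, hp⟩ y hy
    obtain ⟨q, hq, e⟩ := (h S hS).diff p hp y hy
    exact ⟨q, ⟨S, hS, hq⟩, e⟩

theorem IsSaturated.union {S D : Set (G × G)} (hS : IsSaturated S) (hD : IsSaturated D) :
    IsSaturated (S ∪ D) := by
  rw [← sUnion_pair]
  exact .sUnion (by rintro _ (rfl | rfl) <;> assumption)

theorem mk_quotient_range_dbl_eq [Infinite G] (hr : #(dbl G).range < #G) :
    #(G ⧸ (dbl G).range) = #G := by
  refine (mk_quotient_le).antisymm (le_of_not_gt fun h => ?_)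
  have hlt : #(G ⧸ (dbl G).range) * #(dbl G).range < #G := mul_lt_of_lt (aleph0_le_mk G) h hr
  rw [mul_def, ← mk_congr
    (AddSubgroup.addGroupEquivQuotientProdAddSubgroup (s := (dbl G).range))] at hlt
  exact hlt.false

/-- When there are few doubles, the elements of order dividing two meet many of their cosets. -/
theorem le_mk_image_ker_dbl [Infinite G] (hr : #(dbl G).range < #G) :
    #G ≤ #((QuotientAddGroup.mk' (dbl G).range).comp (dbl G).ker.subtype).range := by
  set ψ := (QuotientAddGroup.mk' (dbl G).range).comp (dbl G).ker.subtype
  by_contra! h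
  -- The kernel of ψ is the intersection of G[2] with 2G.
  have hk : #ψ.ker ≤ #(dbl G).range := by
    refine mk_le_of_injective (f := fun x => ⟨x.1.1, ?_⟩) ?_
    · exact (QuotientAddGroup.eq_zero_iff _).1 x.2
    · intro x y e
      exact Subtype.ext (Subtype.ext (Subtype.mk.inj e))
  have h1 : #(dbl G).ker < #G := by
    rw [AddMonoidHom.mk_eq_range_mul_ker ψ]
    exact mul_lt_of_lt (aleph0_le_mk G) h (hk.trans_lt hr)
  have h2 := mul_lt_of_lt (aleph0_le_mk G) hr h1
  rw [← AddMonoidHom.mk_eq_range_mul_ker] at h2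
  exact h2.false

/-- An injective family of cosets represented by elements of order dividing two, avoiding a
prescribed small set. -/
theorem exists_injective_order_two [Infinite G] (hr : #(dbl G).range < #G)
    (Z : Set (G ⧸ (dbl G).range)) (hZ : #Z < #G) :
    ∃ e : (dbl G).range → G, (∀ x, e x + e x = 0) ∧
      (fun x => (e x : G ⧸ (dbl G).range)).Injective ∧ ∀ x, (e x : G ⧸ (dbl G).range) ∉ Z := by
  set ψ := (QuotientAddGroup.mk' (dbl G).range).comp (dbl G).ker.subtype
  have hW : #G ≤ #ψ.range := le_mk_image_ker_dbl hr
  have hdiff : #(dbl G).range ≤ #((ψ.range : Set (G ⧸ (dbl G).range)) \ Z : Set _) := by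
    by_contra! h
    have h1 : #(ψ.range : Set (G ⧸ (dbl G).range)) < #G :=
      (mk_le_mk_of_subset (subset_sdiff_union _ Z)).trans_lt <| (mk_union_le _ Z).trans_lt <|
        add_lt_of_lt (aleph0_le_mk G) (h.trans hr) hZ
    exact absurd hW h1.not_ge
  obtain ⟨k⟩ := hdiff
  choose e he using fun x => (k x).2.1
  have hmk : ∀ x, ((e x : G) : G ⧸ (dbl G).range) = k x := he
  refine ⟨fun x => e x, fun x => ?_, fun x y h => ?_, fun x => ?_⟩
  · rw [← dbl_apply]
    exact (e x).2
  · simp only [hmk] at h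
    exact k.injective (Subtype.ext h)
  · simp only [hmk]
    exact (k x).2.2

/-- A pair whose sum lies in an unused coset of the subgroup of doubles extends to a block of pairs
whose sums and differences both fill that coset. -/
theorem exists_block [Infinite G] (hr : #(dbl G).range < #G) {S : Set (G × G)}
    (hS : IsPartialSCM S) (hsat : IsSaturated S) (hlt : #S < #G) {g h : G}
    (hg : g ∉ Prod.fst '' S) (hh : h ∉ Prod.snd '' S)
    (hgh : ((g + h : G) : G ⧸ (dbl G).range) ∉
      (fun p : G × G => ((p.1 + p.2 : G) : G ⧸ (dbl G).range)) '' S) :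
    ∃ D : Set (G × G), #D ≤ #(dbl G).range ∧ (IsPartialSCM (S ∪ D) ∧ IsSaturated (S ∪ D)) ∧
      (g, h) ∈ D := by
  classical
  let π : G → G ⧸ (dbl G).range := fun x => x
  have im : ∀ k : G × G → G ⧸ (dbl G).range, #(k '' S) < #G := fun k => mk_image_le.trans_lt hlt
  -- The first two excluded sets keep g + e_x and h + x - e_x off the used coordinates, already
  -- modulo 2G; excluding 0 preserves injectivity when the value at 0 is reset.
  obtain ⟨e₀, e₀_two, e₀_inj, e₀_Z⟩ := exists_injective_order_two hr
    (((fun p : G × G => π (p.1 - g)) '' S ∪ (fun p : G × G => π (h - p.2)) '' S) ∪ {0})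
    ((mk_union_le _ _).trans_lt <| add_lt_of_lt (aleph0_le_mk G)
      ((mk_union_le _ _).trans_lt <| add_lt_of_lt (aleph0_le_mk G) (im _) (im _))
      (by simpa using one_lt_aleph0.trans_le (aleph0_le_mk G)))
  -- The value 0 at x = 0 puts (g, h) itself in the block; there g and h are only known to be unused
  -- as elements, not modulo 2G.
  let e : (dbl G).range → G := fun x => if x = 0 then 0 else e₀ x
  have e_zero : e 0 = 0 := if_pos rfl
  have e_ne : ∀ x, x ≠ 0 → e x = e₀ x := fun x hx => if_neg hx
  have e_two : ∀ x, e x + e x = 0 := by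
    intro x
    by_cases hx : x = 0
    · simp [hx, e_zero]
    · rw [e_ne x hx, e₀_two]
  have e_inj : ∀ x y, π (e x) = π (e y) → x = y := by
    intro x y hxy
    by_cases hx : x = 0 <;> by_cases hy : y = 0
    · rw [hx, hy]
    · rw [hx, e_zero, e_ne y hy] at hxy
      exact absurd (Or.inr hxy.symm) (e₀_Z y)
    · rw [hy, e_zero, e_ne x hx] at hxy
      exact absurd (Or.inr hxy) (e₀_Z x)
    · rw [e_ne x hx, e_ne y hy] at hxy
      exact e₀_inj hxy
  have π_coe : ∀ x : (dbl G).range, π x = 0 := fun x => (QuotientAddGroup.eq_zero_iff _).2 x.2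
  have π_add : ∀ a b, π (a + b) = π a + π b := fun a b => rfl
  have π_sub : ∀ a b, π (a - b) = π a - π b := fun a b => rfl
  have π_eq : ∀ {a b}, a - b ∈ (dbl G).range → π a = π b := fun {a b} h =>
    sub_eq_zero.1 ((QuotientAddGroup.eq_zero_iff (a - b)).2 h)
  have two_mem : ∀ a : G, a + a ∈ (dbl G).range := fun a => ⟨a, dbl_apply a⟩
  let P : (dbl G).range → G × G := fun x => (g + e x, h + x - e x)
  have P_sum : ∀ x, (P x).1 + (P x).2 = g + h + x := fun x => by simp only [P]; abel
  have P_diff : ∀ x, -(P x).1 + (P x).2 = -g + h + x := fun x => by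
    calc -(P x).1 + (P x).2 = -g + h + x - (e x + e x) := by simp only [P]; abel
      _ = _ := by rw [e_two, sub_zero]
  have diff_sum : ∀ a b : G, π (-a + b) = π (a + b) := fun a b =>
    (π_eq (by rw [show a + b - (-a + b) = a + a by abel]; exact two_mem a)).symm
  refine ⟨range P, mk_range_le, ⟨hS.union ⟨?_, ?_, ?_, ?_⟩ ?_ ?_ ?_ ?_, hsat.union ⟨?_, ?_⟩⟩,
    0, by simp [P, e_zero]⟩
  · rintro _ ⟨x, rfl⟩ _ ⟨y, rfl⟩ hxy
    rw [e_inj x y (congrArg π (add_left_cancel hxy))]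
  · rintro _ ⟨x, rfl⟩ _ ⟨y, rfl⟩ hxy
    have := congrArg π hxy
    simp only [P, π_sub, π_add, π_coe, add_zero, sub_right_inj] at this
    rw [e_inj x y this]
  · rintro _ ⟨x, rfl⟩ _ ⟨y, rfl⟩ hxy
    simp only [P_sum, add_right_inj] at hxy
    rw [Subtype.ext hxy]
  · rintro _ ⟨x, rfl⟩ _ ⟨y, rfl⟩ hxy
    simp only [P_diff, add_right_inj] at hxy
    rw [Subtype.ext hxy]
  · rintro _ ⟨x, rfl⟩ ⟨p, hp, hpx⟩
    by_cases hx : x = 0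
    · exact hg ⟨p, hp, by simpa [P, hx, e_zero] using hpx⟩
    · refine e₀_Z x (Or.inl (Or.inl ⟨p, hp, congrArg π ?_⟩))
      rw [hpx, ← e_ne x hx]
      simp only [P]; abel
  · rintro _ ⟨x, rfl⟩ ⟨p, hp, hpx⟩
    by_cases hx : x = 0
    · exact hh ⟨p, hp, by simpa [P, hx, e_zero] using hpx⟩
    · refine e₀_Z x (Or.inl (Or.inr ⟨p, hp, ?_⟩))
      have : π (h - p.2) = π (e₀ x) := by
        rw [hpx, ← e_ne x hx]
        simp only [P, π_sub, π_add, π_coe]; abel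
      exact this
  · rintro _ ⟨x, rfl⟩ ⟨p, hp, hpx⟩
    refine hgh ⟨p, hp, ?_⟩
    have : π (p.1 + p.2) = π (g + h) := by
      rw [show p.1 + p.2 = _ from hpx, P_sum, π_add (g + h), π_coe, add_zero]
    exact this
  · rintro _ ⟨x, rfl⟩ ⟨p, hp, hpx⟩
    refine hgh ⟨p, hp, ?_⟩
    have : π (p.1 + p.2) = π (g + h) := by
      rw [← diff_sum, show -p.1 + p.2 = _ from hpx, P_diff, π_add (-g + h), π_coe, add_zero,
        diff_sum]
    exact this
  · rintro _ ⟨x, rfl⟩ y hy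
    have hmem : y - (g + h) ∈ (dbl G).range := by
      rw [P_sum] at hy
      convert sub_mem x.2 hy using 1
      abel
    exact ⟨_, ⟨⟨_, hmem⟩, rfl⟩, by rw [P_sum]; simp⟩
  · rintro _ ⟨x, rfl⟩ y hy
    have hmem : y - (-g + h) ∈ (dbl G).range := by
      rw [P_sum] at hy
      convert add_mem (sub_mem x.2 hy) (two_mem g) using 1
      abel
    exact ⟨_, ⟨⟨_, hmem⟩, rfl⟩, by rw [P_diff]; simp⟩

theorem exists_scm_of_mk_range_dbl_lt [Infinite G] (hr : #(dbl G).range < #G) :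
    ∃ θ : G → G, θ.Bijective ∧ (fun g => -g + θ g).Bijective ∧ (fun g => g + θ g).Bijective := by
  let f : Fin 3 → G × G → G := ![Prod.fst, Prod.snd, fun p => p.1 + p.2]
  have hT : #(Fin 3 × G) = #G := by
    rw [mk_prod]
    simpa using mul_eq_right (aleph0_le_mk G)
      ((natCast_lt_aleph0 (n := 3)).le.trans (aleph0_le_mk G)) (by simp)
  have hQ := mk_quotient_range_dbl_eq hr
  have hinf : Infinite (G ⧸ (dbl G).range) := by
    rw [infinite_iff, hQ]; exact aleph0_le_mk G
  refine (exists_forall_done_of_extension (T := Fin 3 × G)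
    (fun S : Set (G × G) => IsPartialSCM S ∧ IsSaturated S) (fun t S => t.2 ∈ f t.1 '' S)
    #(dbl G).range (by rwa [hT]) (fun t S S' h => fun ht => image_mono h ht)
    (fun c hc h => ⟨.sUnion hc fun S hS => (h S hS).1, .sUnion fun S hS => (h S hS).2⟩) ?_).elim
    fun S ⟨⟨hS, hsat⟩, hd⟩ => hS.exists_map (fun g => hd (0, g)) (fun g => hd (1, g))
      (fun g => hd (2, g)) fun g => ?_
  swap
  -- Differences need no tasks of their own: once g is a sum, saturation makes it a difference.
  · obtain ⟨p, hp, hpg⟩ := hd (2, g)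
    exact hsat.diff p hp g (by rw [show p.1 + p.2 = g from hpg, sub_self]; exact zero_mem _)
  rintro S ⟨i, y⟩ ⟨hS, hsat⟩ hlt
  rw [hT] at hlt
  let π : G → G ⧸ (dbl G).range := fun x => x
  have im : ∀ k : G × G → G ⧸ (dbl G).range, #(k '' S) < #(G ⧸ (dbl G).range) :=
    fun k => mk_image_le.trans_lt (hlt.trans_eq hQ.symm)
  by_cases hy : y ∈ f i '' S
  · exact ⟨∅, by simp, by simpa using ⟨hS, hsat⟩, by simpa using hy⟩
  suffices ∃ p : G × G, f i p = y ∧ p.1 ∉ Prod.fst '' S ∧ p.2 ∉ Prod.snd '' S ∧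
      π (p.1 + p.2) ∉ (fun p : G × G => π (p.1 + p.2)) '' S by
    obtain ⟨p, hp, h₁, h₂, h₃⟩ := this
    obtain ⟨D, hD, hgood, hmem⟩ := exists_block hr hS hsat hlt h₁ h₂ h₃
    exact ⟨D, hD, hgood, p, Or.inr hmem, hp⟩
  have lift : ∀ {k : G × G → G} {a : G}, π a ∉ (fun p => π (k p)) '' S → a ∉ k '' S := by
    rintro k _ h ⟨p, hp, rfl⟩
    exact h ⟨p, hp, rfl⟩
  fin_cases i
  · obtain ⟨w, h₂, h₃, -⟩ := exists_notMem_of_injective (f₁ := fun w => w)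
      (f₂ := fun w => π y + w) (f₃ := fun w => w) (fun _ _ => id) (add_right_injective _)
      (fun _ _ => id) (im fun p => π p.2) (im fun p => π (p.1 + p.2)) (im fun p => π p.2)
    obtain ⟨h, rfl⟩ := QuotientAddGroup.mk_surjective w
    exact ⟨(y, h), rfl, hy, lift h₂, h₃⟩
  · obtain ⟨w, h₁, h₃, -⟩ := exists_notMem_of_injective (f₁ := fun w => w)
      (f₂ := fun w => w + π y) (f₃ := fun w => w) (fun _ _ => id) (add_left_injective _)
      (fun _ _ => id) (im fun p => π p.1) (im fun p => π (p.1 + p.2)) (im fun p => π p.1)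
    obtain ⟨g, rfl⟩ := QuotientAddGroup.mk_surjective w
    exact ⟨(g, y), rfl, lift h₁, hy, h₃⟩
  · obtain ⟨w, h₁, h₂, -⟩ := exists_notMem_of_injective (f₁ := fun w => w)
      (f₂ := fun w => π y - w) (f₃ := fun w => w) (fun _ _ => id) sub_right_injective
      (fun _ _ => id) (im fun p => π p.1) (im fun p => π p.2) (im fun p => π p.1)
    obtain ⟨g, rfl⟩ := QuotientAddGroup.mk_surjective w
    refine ⟨(g, y - g), by simp [f], lift h₁, lift h₂, ?_⟩
    -- If the coset of y already contained a sum, saturation would make y itself a sum already.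
    rintro ⟨p, hp, hpy⟩
    have hpy' : π (p.1 + p.2) = π y := by simpa using hpy
    refine hy (hsat.sum p hp y ?_)
    rw [← QuotientAddGroup.eq_zero_iff]
    exact sub_eq_zero.2 hpy'

theorem exists_scm_of_infinite (G : Type u) [AddCommGroup G] [Infinite G] :
    ∃ θ : G → G, θ.Bijective ∧ (fun g => -g + θ g).Bijective ∧ (fun g => g + θ g).Bijective :=
  (mk_subtype_le _).lt_or_eq.elim exists_scm_of_mk_range_dbl_lt exists_scm_of_mk_range_dbl_eq

end Additive

/-- The construction works in every infinite abelian group, so neither the choice of `E₂` nor the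
condition on the Sylow `3`-subgroups is needed. -/
theorem mainTheorem7 (A : Type*) [CommGroup A] [Infinite A]
    (E₂ : Subgroup A) (hE₂ : IsRestrictedTwoSubgroup E₂)
    (hA : ¬ (Finite (A ⧸ E₂) ∧ ∃ P : Sylow 3 (A ⧸ E₂), Nontrivial P ∧ IsCyclic P)) :
    ∃ θ : A → A, IsStrongCompleteMapping θ := by
  obtain ⟨θ, h₁, h₂, h₃⟩ := exists_scm_of_infinite (Additive A)
  exact ⟨θ, ⟨h₁, h₂⟩, h₁, h₃⟩
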